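/- Let $M$ be a finite abelian group and let $$1\longrightarrow M\longrightarrow\Omega\longrightarrow\Pi\longrightarrow1$$ be an exact sequence of prodiscrete groups, that is, of topological groups which are inverse limits of discrete groups; here $M$ is discrete and embedded in $\Omega$, and $\Pi$ carries the quotient topology. Let $A$ be a discrete $\Pi$-module, regarded as an $\Omega$-module through $\Omega\to\Pi$, and let $H^*$ denote continuous cohomology, defined by continuous inhomogeneous cochains. Equip $M$ with the $\Pi$-module structure given by conjugation with lifts to $\Omega$, and $\mathrm{Hom}(M,A)$ with $(g\varphi)(m)=g\,\varphi(g^{-1}m)$. Put $$H^2(\Omega,A)_0=\ker\big(H^2(\Omega,A)\to H^2(M,A)\big),$$ and let $$\delta:H^2(\Omega,A)_0\longrightarrow H^1(\Pi,H^1(M,A))=H^1(\Pi,\mathrm{Hom}(M,A))$$ be the homomorphism furnished by the Hochschild--Serre spectral sequence $H^p(\Pi,H^q(M,A))\Rightarrow H^{p+q}(\Omega,A)$. Here the spectral sequence is that of the Hochschild--Serre filtration of the cochain complex of $\Omega$, where $F^pC^n$ consists, for $p\le n$, of the cochains $f(x_1,\dots,x_n)$ that depend only on $x_1,\dots,x_{n-p}$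 and on the cosets $x_{n-p+1}M,\dots,x_nM$, and $F^pC^n=0$ for $p>n$. The term $E_2^{1,1}$ is identified with $H^1(\Pi,\mathrm{Hom}(M,A))$ by sending the class of $f$ to the class of $g\mapsto\big(m\mapsto f(m,\tilde g)-f(1,\tilde g)\big)$, where $\tilde g\in\Omega$ is any lift of $g$. For continuous homomorphic sections $s_1,s_2:\Pi\to\Omega$ of the exact sequence, let $[s_1-s_2]\in H^1(\Pi,M)$ be the class of the cocycle $g\mapsto s_1(g)s_2(g)^{-1}$, and let $$\cup:H^1(\Pi,M)\times H^1(\Pi,\mathrm{Hom}(M,A))\longrightarrow H^2(\Pi,A)$$ be the cup product induced by the evaluation map $M\otimes\mathrm{Hom}(M,A)\to A$, given on cochains by $(u\cup v)(g,h)=(g\,v(h))(u(g))$. Then for every $c\in H^2(\Omega,A)_0$ and every pair of sections $s_1,s_2$ we have $$s_1^*(c)-s_2^*(c)=[s_1-s_2]\cup\delta(c)\in H^2(\Pi,A).$$ -/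

import Mathlib

set_option linter.unusedSectionVars false

namespace DiscreteCohomology

section Cochains

variable {G A : Type*} [Group G] [TopologicalSpace G] [AddCommGroup A]

/-- An abelian group `A` with an action `ρ` of the topological group `G` is a discrete `G`-module:
the action is continuous for the discrete topology on `A`. -/
class IsDiscreteModule (ρ : G →* AddMonoid.End A) : Prop where
  isLocallyConstant : ∀ a : A, IsLocallyConstant fun g : G => ρ g a

variable (G A) in
/-- The group of continuous inhomogeneous `n`-cochains of `G` with values in the discrete group `A`
(a map to a discrete space is continuous if and only if it is locally constant). -/
def C (n : ℕ) : AddSubgroup ((Fin n → G) → A) where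
  carrier := {f | IsLocallyConstant f}
  zero_mem' := IsLocallyConstant.const 0
  add_mem' hf hg := hf.add hg
  neg_mem' hf := hf.neg

/-- The differential of the inhomogeneous cochain complex:
`(d f)(g₀, …, gₙ) = g₀ f(g₁, …, gₙ) + ∑ⱼ (-1)^(j+1) f(…, gⱼ gⱼ₊₁, …)`, where the term `j = n` of the
sum is `(-1)^(n+1) f(g₀, …, gₙ₋₁)`. -/
def d (ρ : G →* AddMonoid.End A) (n : ℕ) :
    ((Fin n → G) → A) →+ ((Fin (n + 1) → G) → A) where
  toFun f g := ρ (g 0) (f fun i => g i.succ) +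
    ∑ j : Fin (n + 1), (-1 : ℤ) ^ ((j : ℕ) + 1) • f (Fin.contractNth j (· * ·) g)
  map_zero' := by ext; simp
  map_add' f f' := by
    ext
    simp [Finset.sum_add_distrib, add_add_add_comm]

/-- Continuous `n`-cocycles. -/
def Z (ρ : G →* AddMonoid.End A) (n : ℕ) : AddSubgroup ((Fin n → G) → A) :=
  C G A n ⊓ (d ρ n).ker

/-- Continuous `n`-coboundaries. -/
def B (ρ : G →* AddMonoid.End A) : (n : ℕ) → AddSubgroup ((Fin n → G) → A)
  | 0 => ⊥
  | n + 1 => (C G A n).map (d ρ n)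

/-- The continuous cohomology group `Hⁿ(G, A)`. -/
abbrev H (ρ : G →* AddMonoid.End A) (n : ℕ) : Type _ :=
  Z ρ n ⧸ (B ρ n).addSubgroupOf (Z ρ n)

lemma d_one (ρ : G →* AddMonoid.End A) (f : (Fin 1 → G) → A) (x y : G) :
    d ρ 1 f ![x, y] = ρ x (f ![y]) - f ![x * y] + f ![x] := by
  have h0 : (fun i : Fin 1 => (![x, y] : Fin 2 → G) i.succ) = ![y] := by
    ext i; fin_cases i; rfl
  have h1 : Fin.contractNth (0 : Fin 2) (· * ·) ![x, y] = ![x * y] := by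
    ext i; fin_cases i; rfl
  have h2 : Fin.contractNth (1 : Fin 2) (· * ·) ![x, y] = ![x] := by
    ext i; fin_cases i; rfl
  change ρ x (f fun i : Fin 1 => (![x, y] : Fin 2 → G) i.succ) + ∑ j : Fin 2, _ = _
  rw [h0, Fin.sum_univ_two, h1, h2]
  simp
  abel

lemma d_two (ρ : G →* AddMonoid.End A) (f : (Fin 2 → G) → A) (x y z : G) :
    d ρ 2 f ![x, y, z] = ρ x (f ![y, z]) - f ![x * y, z] + f ![x, y * z] - f ![x, y] := by
  have h0 : (fun i : Fin 2 => (![x, y, z] : Fin 3 → G) i.succ) = ![y, z] := by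
    ext i; fin_cases i <;> rfl
  have h1 : Fin.contractNth (0 : Fin 3) (· * ·) ![x, y, z] = ![x * y, z] := by
    ext i; fin_cases i <;> rfl
  have h2 : Fin.contractNth (1 : Fin 3) (· * ·) ![x, y, z] = ![x, y * z] := by
    ext i; fin_cases i <;> rfl
  have h3 : Fin.contractNth (2 : Fin 3) (· * ·) ![x, y, z] = ![x, y] := by
    ext i; fin_cases i <;> rfl
  change ρ x (f fun i : Fin 2 => (![x, y, z] : Fin 3 → G) i.succ) + ∑ j : Fin 3, _ = _
  rw [h0, Fin.sum_univ_three, h1, h2, h3]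
  simp
  abel

lemma d_zero (ρ : G →* AddMonoid.End A) (f : (Fin 0 → G) → A) (x : G) :
    d ρ 0 f ![x] = ρ x (f ![]) - f ![] := by
  have h0 : (fun i : Fin 0 => (![x] : Fin 1 → G) i.succ) = ![] := Subsingleton.elim _ _
  have h1 : Fin.contractNth (0 : Fin 1) (· * ·) ![x] = ![] := Subsingleton.elim _ _
  change ρ x (f fun i : Fin 0 => (![x] : Fin 1 → G) i.succ) + ∑ j : Fin 1, _ = _
  rw [h0, Fin.sum_univ_one, h1]
  simp
  abel

lemma vec_one (g : Fin 1 → G) : g = ![g 0] := by ext i; fin_cases i; rfl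

lemma vec_two (g : Fin 2 → G) : g = ![g 0, g 1] := by ext i; fin_cases i <;> rfl

lemma vec_three (g : Fin 3 → G) : g = ![g 0, g 1, g 2] := by ext i; fin_cases i <;> rfl

lemma mem_Z_one {ρ : G →* AddMonoid.End A} {f : (Fin 1 → G) → A} :
    f ∈ Z ρ 1 ↔ IsLocallyConstant f ∧ ∀ x y, f ![x * y] = f ![x] + ρ x (f ![y]) := by
  refine and_congr Iff.rfl ?_
  change d ρ 1 f = 0 ↔ _
  rw [funext_iff]
  constructor
  · intro h x y
    have := h ![x, y]
    rw [d_one, Pi.zero_apply] at this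
    rw [← sub_eq_zero, ← neg_eq_zero, ← this]; abel
  · intro h g
    rw [vec_two g, d_one, h, Pi.zero_apply]; abel

lemma mem_Z_two {ρ : G →* AddMonoid.End A} {f : (Fin 2 → G) → A} :
    f ∈ Z ρ 2 ↔ IsLocallyConstant f ∧
      ∀ x y z, ρ x (f ![y, z]) - f ![x * y, z] + f ![x, y * z] - f ![x, y] = 0 := by
  refine and_congr Iff.rfl ?_
  change d ρ 2 f = 0 ↔ _
  rw [funext_iff]
  constructor
  · intro h x y z
    rw [← d_two, h]; rfl
  · intro h g
    rw [vec_three g, d_two, h, Pi.zero_apply]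

lemma IsDiscreteModule.smul (ρ : G →* AddMonoid.End A) [IsDiscreteModule ρ] {X : Type*}
    [TopologicalSpace X] {F : X → G} (hF : Continuous F) {f : X → A} (hf : IsLocallyConstant f) :
    IsLocallyConstant fun x => ρ (F x) (f x) := by
  rw [IsLocallyConstant.iff_eventually_eq]
  intro x
  have h := (IsDiscreteModule.isLocallyConstant (ρ := ρ) (f x)).comp_continuous hF
  filter_upwards [h.eventually_eq x, hf.eventually_eq x] with y h1 h2
  rw [h2]; exact h1

end Cochains

section Functoriality

variable {G G' A : Type*} [Group G] [TopologicalSpace G] [Group G'] [TopologicalSpace G']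
  [AddCommGroup A]

/-- Pull-back of cochains along a homomorphism. -/
def pull (φ : G' →ₜ* G) (n : ℕ) : ((Fin n → G) → A) →+ ((Fin n → G') → A) where
  toFun f g := f (φ ∘ g)
  map_zero' := rfl
  map_add' _ _ := rfl

lemma pull_mem_C (φ : G' →ₜ* G) (n : ℕ) {f : (Fin n → G) → A} (hf : f ∈ C G A n) :
    pull φ n f ∈ C G' A n :=
  IsLocallyConstant.comp_continuous (f := fun g : Fin n → G' => φ ∘ g) (g := f) hf
    (continuous_pi fun i => φ.continuous_toFun.comp (continuous_apply i))

lemma d_pull (φ : G' →ₜ* G) {ρ : G →* AddMonoid.End A} {ρ' : G' →* AddMonoid.End A}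
    (h : ∀ g, ρ' g = ρ (φ g)) (n : ℕ) (f : (Fin n → G) → A) :
    d ρ' n (pull φ n f) = pull φ (n + 1) (d ρ n f) := by
  ext g
  simp only [d, pull, AddMonoidHom.coe_mk, ZeroHom.coe_mk, h, Function.comp_apply]
  congr 1
  refine Finset.sum_congr rfl fun j _ => ?_
  congr 2
  ext k
  simp only [Fin.contractNth, Function.comp_apply]
  split_ifs <;> simp

lemma pull_mem_Z (φ : G' →ₜ* G) {ρ : G →* AddMonoid.End A} {ρ' : G' →* AddMonoid.End A}
    (h : ∀ g, ρ' g = ρ (φ g)) (n : ℕ) {f : (Fin n → G) → A} (hf : f ∈ Z ρ n) :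
    pull φ n f ∈ Z ρ' n := by
  refine ⟨pull_mem_C φ n hf.1, ?_⟩
  change d ρ' n (pull φ n f) = 0
  rw [d_pull φ h, AddMonoidHom.mem_ker.1 hf.2, map_zero]

lemma pull_mem_B (φ : G' →ₜ* G) {ρ : G →* AddMonoid.End A} {ρ' : G' →* AddMonoid.End A}
    (h : ∀ g, ρ' g = ρ (φ g)) (n : ℕ) {f : (Fin n → G) → A} (hf : f ∈ B ρ n) :
    pull φ n f ∈ B ρ' n := by
  cases n with
  | zero =>
    obtain rfl : f = 0 := hf
    rw [map_zero]; exact zero_mem _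
  | succ n =>
    obtain ⟨g, hg, rfl⟩ := hf
    exact ⟨pull φ n g, pull_mem_C φ n hg, d_pull φ h n g⟩

/-- The homomorphism `φ^* : Hⁿ(G, A) → Hⁿ(G', A)` induced by a continuous homomorphism
`φ : G' → G`, where `G'` acts on `A` through `φ`. -/
def H.map (φ : G' →ₜ* G) {ρ : G →* AddMonoid.End A} {ρ' : G' →* AddMonoid.End A}
    (h : ∀ g, ρ' g = ρ (φ g)) (n : ℕ) : H ρ n →+ H ρ' n :=
  QuotientAddGroup.map _ _
    (((pull φ n).comp (Z ρ n).subtype).codRestrict (Z ρ' n) fun f => pull_mem_Z φ h n f.2)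
    fun f hf => pull_mem_B φ h n (f := f.1) hf

end Functoriality

section Cup

variable {G A A' A'' : Type*} [Group G] [TopologicalSpace G] [IsTopologicalGroup G]
  [AddCommGroup A] [AddCommGroup A'] [AddCommGroup A'']

/-- The cup product of `1`-cochains with respect to a bi-additive map `b`:
`(u ∪ v)(x, y) = b(u(x), x v(y))`. -/
def cupCochain (ρ' : G →* AddMonoid.End A') (b : A →+ A' →+ A'')
    (u : (Fin 1 → G) → A) (v : (Fin 1 → G) → A') : (Fin 2 → G) → A'' :=
  fun g => b (u ![g 0]) (ρ' (g 0) (v ![g 1]))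

variable {ρ : G →* AddMonoid.End A} {ρ' : G →* AddMonoid.End A'} {ρ'' : G →* AddMonoid.End A''}

lemma cupCochain_mem_Z [IsDiscreteModule ρ'] (b : A →+ A' →+ A'')
    (hb : ∀ g a a', b (ρ g a) (ρ' g a') = ρ'' g (b a a'))
    {u : (Fin 1 → G) → A} {v : (Fin 1 → G) → A'} (hu : u ∈ Z ρ 1) (hv : v ∈ Z ρ' 1) :
    cupCochain ρ' b u v ∈ Z ρ'' 2 := by
  rw [mem_Z_one] at hu hv
  rw [mem_Z_two]
  constructor
  · refine IsLocallyConstant.comp₂ (f := fun g : Fin 2 → G => u ![g 0])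
      (g := fun g : Fin 2 → G => ρ' (g 0) (v ![g 1])) ?_ ?_ (fun a a' => b a a')
    · exact hu.1.comp_continuous (by fun_prop)
    · exact IsDiscreteModule.smul ρ' (by fun_prop) (hv.1.comp_continuous (by fun_prop))
  · intro x y z
    simp only [cupCochain, Matrix.cons_val_zero, Matrix.cons_val_one, hu.2, hv.2, map_add, map_mul,
      AddMonoidHom.add_apply, ← hb, AddMonoid.End.coe_mul, Function.comp_apply]
    abel

lemma cupCochain_mem_B_left [IsDiscreteModule ρ'] (b : A →+ A' →+ A'')
    (hb : ∀ g a a', b (ρ g a) (ρ' g a') = ρ'' g (b a a'))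
    {u : (Fin 1 → G) → A} {v : (Fin 1 → G) → A'} (hu : u ∈ B ρ 1) (hv : v ∈ Z ρ' 1) :
    cupCochain ρ' b u v ∈ B ρ'' 2 := by
  obtain ⟨a, -, rfl⟩ := hu
  rw [mem_Z_one] at hv
  refine ⟨fun g => b (a ![]) (v g), hv.1.comp (fun t => b (a ![]) t), ?_⟩
  ext g
  rw [vec_two g, d_one]
  simp only [cupCochain, Matrix.cons_val_zero, Matrix.cons_val_one, d_zero, hv.2, map_add, map_sub,
    AddMonoidHom.sub_apply, ← hb]
  abel

lemma cupCochain_mem_B_right [IsDiscreteModule ρ'] (b : A →+ A' →+ A'')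
    (hb : ∀ g a a', b (ρ g a) (ρ' g a') = ρ'' g (b a a'))
    {u : (Fin 1 → G) → A} {v : (Fin 1 → G) → A'} (hu : u ∈ Z ρ 1) (hv : v ∈ B ρ' 1) :
    cupCochain ρ' b u v ∈ B ρ'' 2 := by
  obtain ⟨a, -, rfl⟩ := hv
  rw [mem_Z_one] at hu
  refine ⟨fun g => - b (u g) (ρ' (g 0) (a ![])), ?_, ?_⟩
  · refine (IsLocallyConstant.comp₂ hu.1 (g := fun g : Fin 1 → G => ρ' (g 0) (a ![])) ?_
      (fun a a' => b a a')).neg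
    exact IsDiscreteModule.smul ρ' (by fun_prop) (IsLocallyConstant.const _)
  · ext g
    rw [vec_two g, d_one]
    simp only [cupCochain, Matrix.cons_val_zero, Matrix.cons_val_one, d_zero, hu.2, map_add,
      map_sub, map_neg, map_mul, AddMonoid.End.coe_mul, Function.comp_apply, AddMonoidHom.add_apply, ← hb]
    abel

/-- The cup product `H¹(G, A) × H¹(G, A') → H²(G, A'')` induced by a `G`-equivariant bi-additive map
`b : A × A' → A''`, as a bi-additive map. -/
def cup [IsDiscreteModule ρ'] (b : A →+ A' →+ A'')
    (hb : ∀ g a a', b (ρ g a) (ρ' g a') = ρ'' g (b a a')) : H ρ 1 →+ H ρ' 1 →+ H ρ'' 2 :=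
  QuotientAddGroup.lift _
    { toFun := fun u => QuotientAddGroup.lift _
        { toFun := fun v => QuotientAddGroup.mk ⟨cupCochain ρ' b u v, cupCochain_mem_Z b hb u.2 v.2⟩
          map_zero' := by
            rw [QuotientAddGroup.eq_zero_iff, AddSubgroup.mem_addSubgroupOf]
            exact cupCochain_mem_B_right b hb u.2 (zero_mem _)
          map_add' := fun v v' => by
            rw [← QuotientAddGroup.mk_add]
            congr 2
            ext g
            simp [cupCochain] }
        (fun v hv => by
          rw [AddMonoidHom.mem_ker, AddMonoidHom.coe_mk, ZeroHom.coe_mk,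
            QuotientAddGroup.eq_zero_iff, AddSubgroup.mem_addSubgroupOf]
          exact cupCochain_mem_B_right b hb u.2 hv)
      map_zero' := by
        ext v
        simp only [AddMonoidHom.comp_apply, QuotientAddGroup.mk'_apply, QuotientAddGroup.lift_mk,
          AddMonoidHom.coe_mk, ZeroHom.coe_mk, AddMonoidHom.zero_apply]
        rw [QuotientAddGroup.eq_zero_iff, AddSubgroup.mem_addSubgroupOf]
        exact cupCochain_mem_B_left b hb (zero_mem _) v.2
      map_add' := fun u u' => by
        ext v
        simp only [AddMonoidHom.comp_apply, QuotientAddGroup.mk'_apply, QuotientAddGroup.lift_mk,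
          AddMonoidHom.coe_mk, ZeroHom.coe_mk, AddMonoidHom.add_apply]
        rw [← QuotientAddGroup.mk_add]
        congr 2
        ext g
        simp [cupCochain] }
    (fun u hu => by
      rw [AddMonoidHom.mem_ker]
      ext v
      simp only [AddMonoidHom.comp_apply, QuotientAddGroup.mk'_apply, QuotientAddGroup.lift_mk,
        AddMonoidHom.coe_mk, ZeroHom.coe_mk, AddMonoidHom.zero_apply]
      rw [QuotientAddGroup.eq_zero_iff, AddSubgroup.mem_addSubgroupOf]
      exact cupCochain_mem_B_left b hb hu v.2)

end Cup

section Extension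

/-- A topological group is prodiscrete if it is the limit of its discrete quotients: it is Hausdorff,
its open normal subgroups form a basis of neighbourhoods of `1`, and every compatible family of
cosets of its open normal subgroups comes from an element of the group. -/
class IsProdiscrete (G : Type*) [Group G] [TopologicalSpace G] : Prop
    extends IsTopologicalGroup G, T2Space G where
  exists_openNormalSubgroup_subset : ∀ V ∈ nhds (1 : G), ∃ U : OpenNormalSubgroup G, (U : Set G) ⊆ V
  exists_of_compatible : ∀ x : OpenNormalSubgroup G → G,
    (∀ U V : OpenNormalSubgroup G, U ≤ V → (x U)⁻¹ * x V ∈ V) →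
      ∃ g : G, ∀ U : OpenNormalSubgroup G, (x U)⁻¹ * g ∈ U

/-- An exact sequence `1 → M → Ω → Q → 1` of prodiscrete groups with `M` discrete: the group `M` is
embedded in `Ω`, and `Q` has the quotient topology. -/
structure ProdiscreteExtension (M Ω Q : Type*) [CommGroup M] [TopologicalSpace M]
    [Group Ω] [TopologicalSpace Ω] [Group Q] [TopologicalSpace Q]
    extends GroupExtension M Ω Q where
  isEmbedding_inl : Topology.IsEmbedding inl
  isOpenQuotientMap_rightHom : IsOpenQuotientMap rightHom

namespace ProdiscreteExtension

variable {M Ω Q A : Type*} [CommGroup M] [TopologicalSpace M]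
  [Group Ω] [TopologicalSpace Ω] [Group Q] [TopologicalSpace Q]
  [AddCommGroup A]

section Basic

variable (S : ProdiscreteExtension M Ω Q)

/-- The inclusion `M → Ω` as a continuous homomorphism. -/
def incl : M →ₜ* Ω := ⟨S.inl, S.isEmbedding_inl.continuous⟩

/-- The projection `Ω → Q` as a continuous homomorphism. -/
def proj : Ω →ₜ* Q := ⟨S.rightHom, S.isOpenQuotientMap_rightHom.continuous⟩

/-- A section of the extension: a continuous homomorphism `Q → Ω` which is right inverse to the
projection `Ω → Q`. -/
structure ContSection where
  hom : Q →ₜ* Ω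
  proj_hom : ∀ g, S.proj (hom g) = g

lemma proj_incl (m : M) : S.proj (S.incl m) = 1 := S.toGroupExtension.rightHom_inl m

lemma exists_incl {x : Ω} (hx : S.proj x = 1) : ∃ m, S.incl m = x := by
  have : x ∈ S.inl.range := by
    rw [S.range_inl_eq_ker_rightHom]; exact hx
  exact this

lemma exists_eq_mul {x y : Ω} (h : S.proj x = S.proj y) : ∃ m, y = x * S.incl m := by
  obtain ⟨m, hm⟩ := S.exists_incl (x := x⁻¹ * y) (by rw [map_mul, map_inv, h, inv_mul_cancel])
  exact ⟨m, by rw [hm, mul_inv_cancel_left]⟩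

lemma incl_injective : Function.Injective S.incl := S.inl_injective

/-- A set-theoretic lift of an element of `Q` to `Ω`. -/
noncomputable def lift (g : Q) : Ω := Function.surjInv S.rightHom_surjective g

lemma proj_lift (g : Q) : S.proj (S.lift g) = g := Function.surjInv_eq S.rightHom_surjective g

lemma conjAct_eq {x y : Ω} (h : S.proj x = S.proj y) (m : M) : S.conjAct x m = S.conjAct y m := by
  apply S.inl_injective
  rw [S.inl_conjAct_comm, S.inl_conjAct_comm]
  obtain ⟨n, rfl⟩ := S.exists_eq_mul h
  change _ = x * S.inl n * S.inl m * (x * S.inl n)⁻¹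
  have : S.inl n * S.inl m = S.inl m * S.inl n := by rw [← map_mul, ← map_mul, mul_comm]
  calc x * S.inl m * x⁻¹ = x * (S.inl m * S.inl n) * (S.inl n)⁻¹ * x⁻¹ := by group
    _ = x * S.inl n * S.inl m * (x * S.inl n)⁻¹ := by rw [← this]; group

/-- The `Q`-module structure of `M`: `g ∈ Q` acts by conjugation with any lift of `g` to `Ω`. -/
noncomputable def act : Q →* AddMonoid.End (Additive M) where
  toFun g := MonoidHom.toAdditive (S.conjAct (S.lift g)).toMonoidHom
  map_one' := by
    ext m
    have h : S.conjAct (S.lift 1) m = S.conjAct 1 m :=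
      S.conjAct_eq (by rw [S.proj_lift, map_one]) m
    rw [map_one] at h
    exact congrArg Additive.ofMul h
  map_mul' g g' := by
    ext m
    have h : S.conjAct (S.lift (g * g')) m = S.conjAct (S.lift g * S.lift g') m :=
      S.conjAct_eq (by rw [map_mul, S.proj_lift, S.proj_lift, S.proj_lift]) m
    rw [map_mul] at h
    exact congrArg Additive.ofMul h

lemma incl_act (x : Ω) (m : Additive M) :
    S.incl (S.act (S.proj x) m).toMul = x * S.incl m.toMul * x⁻¹ := by
  have h : (S.act (S.proj x) m).toMul = S.conjAct x m.toMul :=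
    S.conjAct_eq (S.proj_lift _) _
  rw [h]
  exact S.inl_conjAct_comm

/-- The `Q`-module structure of `Hom(M, A)`: `(g • φ)(m) = g • φ(g⁻¹ • m)`. -/
noncomputable def homAct (ρ : Q →* AddMonoid.End A) : Q →* AddMonoid.End (Additive M →+ A) where
  toFun g :=
    { toFun := fun φ => AddMonoidHom.comp (ρ g) (AddMonoidHom.comp φ (S.act g⁻¹))
      map_zero' := AddMonoidHom.ext fun m => map_zero (ρ g)
      map_add' := fun φ ψ => AddMonoidHom.ext fun m => map_add (ρ g) _ _ }
  map_one' := by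
    refine AddMonoidHom.ext fun φ => AddMonoidHom.ext fun m => ?_
    change ρ 1 (φ (S.act 1⁻¹ m)) = φ m
    rw [inv_one, map_one, map_one]
    rfl
  map_mul' g h := by
    refine AddMonoidHom.ext fun φ => AddMonoidHom.ext fun m => ?_
    change ρ (g * h) (φ (S.act (g * h)⁻¹ m)) = ρ g (ρ h (φ (S.act h⁻¹ (S.act g⁻¹ m))))
    rw [mul_inv_rev, map_mul, map_mul]
    rfl

lemma homAct_apply (ρ : Q →* AddMonoid.End A) (g : Q) (φ : Additive M →+ A) (m : Additive M) :
    S.homAct ρ g φ m = ρ g (φ (S.act g⁻¹ m)) := rfl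

lemma isLocallyConstant_of_comp {X : Type*} {f : Q → X}
    (h : IsLocallyConstant fun x => f (S.proj x)) : IsLocallyConstant f := fun s =>
  S.isOpenQuotientMap_rightHom.isQuotientMap.isOpen_preimage.1 (h s)

lemma isLocallyConstant_of_incl [DiscreteTopology M] {X : Type*} [TopologicalSpace X] {f : X → M}
    (h : Continuous fun x => S.incl (f x)) : IsLocallyConstant f :=
  (IsLocallyConstant.iff_continuous f).2 (S.isEmbedding_inl.continuous_iff.2 h)

instance isDiscreteModule_act [IsTopologicalGroup Ω] [DiscreteTopology M] :
    IsDiscreteModule S.act where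
  isLocallyConstant m := by
    refine S.isLocallyConstant_of_comp ?_
    refine IsLocallyConstant.comp (f := fun x => (S.act (S.proj x) m).toMul) ?_ Additive.ofMul
    refine S.isLocallyConstant_of_incl ?_
    simp only [incl_act]
    fun_prop

instance isDiscreteModule_homAct [IsTopologicalGroup Ω] [IsTopologicalGroup Q] [Finite M]
    [DiscreteTopology M] (ρ : Q →* AddMonoid.End A) [IsDiscreteModule ρ] :
    IsDiscreteModule (S.homAct ρ) where
  isLocallyConstant φ := by
    rw [IsLocallyConstant.iff_eventually_eq]
    intro g
    have key : ∀ᶠ h in nhds g, ∀ m : M,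
        S.homAct ρ h φ (Additive.ofMul m) = S.homAct ρ g φ (Additive.ofMul m) := by
      rw [Filter.eventually_all]
      intro m
      have h1 : IsLocallyConstant fun h : Q => φ (S.act h⁻¹ (Additive.ofMul m)) :=
        ((IsDiscreteModule.isLocallyConstant (ρ := S.act) (Additive.ofMul m)).comp_continuous
          continuous_inv).comp φ
      exact (IsDiscreteModule.smul ρ continuous_id h1).eventually_eq g
    filter_upwards [key] with h hh
    exact AddMonoidHom.ext hh

/-- Evaluation `M × Hom(M, A) → A`. -/
def ev : Additive M →+ (Additive M →+ A) →+ A := AddMonoidHom.eval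

lemma ev_equivariant (ρ : Q →* AddMonoid.End A) (g : Q) (m : Additive M) (φ : Additive M →+ A) :
    ev (S.act g m) (S.homAct ρ g φ) = ρ g (ev m φ) := by
  change ρ g (φ (S.act g⁻¹ (S.act g m))) = ρ g (φ m)
  have : S.act g⁻¹ (S.act g m) = m := by
    change (S.act g⁻¹ * S.act g) m = m
    rw [← map_mul, inv_mul_cancel, map_one]
    rfl
  rw [this]

variable {S} in
/-- The cocycle `g ↦ s₁(g) s₂(g)⁻¹` with values in `M`. -/
noncomputable def diffCochain (s₁ s₂ : S.ContSection) : (Fin 1 → Q) → Additive M :=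
  fun g => Additive.ofMul (Classical.choose
    (S.exists_incl (x := s₁.hom (g 0) * (s₂.hom (g 0))⁻¹)
      (by rw [map_mul, map_inv, s₁.proj_hom, s₂.proj_hom, mul_inv_cancel])))

variable {S} in
lemma incl_diffCochain (s₁ s₂ : S.ContSection) (g : Fin 1 → Q) :
    S.incl (diffCochain s₁ s₂ g).toMul = s₁.hom (g 0) * (s₂.hom (g 0))⁻¹ :=
  Classical.choose_spec
    (S.exists_incl (x := s₁.hom (g 0) * (s₂.hom (g 0))⁻¹)
      (by rw [map_mul, map_inv, s₁.proj_hom, s₂.proj_hom, mul_inv_cancel]))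

variable {S} in
lemma diffCochain_mem_Z [IsTopologicalGroup Ω] [DiscreteTopology M] (s₁ s₂ : S.ContSection) :
    diffCochain s₁ s₂ ∈ Z S.act 1 := by
  rw [mem_Z_one]
  constructor
  · refine IsLocallyConstant.comp (f := fun g => (diffCochain s₁ s₂ g).toMul) ?_ Additive.ofMul
    refine S.isLocallyConstant_of_incl ?_
    simp only [incl_diffCochain]
    have h1 : Continuous s₁.hom := s₁.hom.continuous_toFun
    have h2 : Continuous s₂.hom := s₂.hom.continuous_toFun
    fun_prop
  · intro x y
    apply Additive.toMul.injective
    apply S.incl_injective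
    have h := S.incl_act (s₂.hom x) (diffCochain s₁ s₂ ![y])
    rw [s₂.proj_hom] at h
    rw [toMul_add, map_mul, h, incl_diffCochain, incl_diffCochain, incl_diffCochain]
    simp only [Matrix.cons_val_zero, map_mul]
    group

variable {S} in
/-- The class `[s₁ - s₂] ∈ H¹(Q, M)` of the cocycle `g ↦ s₁(g) s₂(g)⁻¹`. -/
noncomputable def diffClass [IsTopologicalGroup Ω] [DiscreteTopology M] (s₁ s₂ : S.ContSection) :
    H S.act 1 :=
  QuotientAddGroup.mk ⟨diffCochain s₁ s₂, diffCochain_mem_Z s₁ s₂⟩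

end Basic

section HochschildSerre

variable (S : ProdiscreteExtension M Ω Q) (ρ : Q →* AddMonoid.End A)

/-- The `Q`-module `A` viewed as an `Ω`-module through the projection `Ω → Q`. -/
def infl : Ω →* AddMonoid.End A := ρ.comp S.proj.toMonoidHom

/-- The `Q`-module `A` viewed as an `M`-module (with the trivial action) through `M → Ω → Q`. -/
def trivAct : M →* AddMonoid.End A := (S.infl ρ).comp S.incl.toMonoidHom

lemma infl_apply (x : Ω) : S.infl ρ x = ρ (S.proj x) := rfl

lemma infl_incl (m : M) : S.infl ρ (S.incl m) = 1 := by
  rw [infl_apply, proj_incl, map_one]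

/-- The restriction map `H²(Ω, A) → H²(M, A)`. -/
def res : H (S.infl ρ) 2 →+ H (S.trivAct ρ) 2 := H.map S.incl (fun _ => rfl) 2

/-- The pull-back `s^* : H²(Ω, A) → H²(Q, A)` along a section `s`. -/
def pullSection (s : S.ContSection) : H (S.infl ρ) 2 →+ H ρ 2 :=
  H.map s.hom (fun g => by rw [infl_apply, s.proj_hom]) 2

variable (A) in
/-- The Hochschild-Serre filtration of the cochain complex `C^*(Ω, A)`: for `p ≤ n`, the subgroup
`Fᵖ Cⁿ` consists of the continuous cochains `f(x₁, …, xₙ)` which depend only on `x₁, …, xₙ₋ₚ` and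
on the cosets `xₙ₋ₚ₊₁ M, …, xₙ M`, and `Fᵖ Cⁿ = 0` for `p > n`. -/
def Fil (p n : ℕ) : AddSubgroup ((Fin n → Ω) → A) where
  carrier := {f | f ∈ C Ω A n ∧
    (∀ x y : Fin n → Ω, (∀ i : Fin n, (i : ℕ) + p < n → x i = y i) → (∀ i, S.proj (x i) = S.proj (y i)) →
      f x = f y) ∧
    (n < p → f = 0)}
  zero_mem' := ⟨zero_mem _, fun _ _ _ _ => rfl, fun _ => rfl⟩
  add_mem' hf hg := ⟨add_mem hf.1 hg.1,
    fun x y h h' => congrArg₂ (· + ·) (hf.2.1 x y h h') (hg.2.1 x y h h'),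
    fun h => by rw [hf.2.2 h, hg.2.2 h, add_zero]⟩
  neg_mem' hf := ⟨neg_mem hf.1, fun x y h h' => congrArg (- ·) (hf.2.1 x y h h'),
    fun h => by rw [hf.2.2 h, neg_zero]⟩

/-- For the spectral sequence of the filtered complex `Fᵖ Cⁿ`: the group
`Z_r^{p, n - p} = {f ∈ Fᵖ Cⁿ | d f ∈ Fᵖ⁺ʳ Cⁿ⁺¹}`. -/
def cyc (r p n : ℕ) : AddSubgroup ((Fin n → Ω) → A) :=
  S.Fil A p n ⊓ (S.Fil A (p + r) (n + 1)).comap (d (S.infl ρ) n)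

/-- For the spectral sequence of the filtered complex `Fᵖ Cⁿ`: the group
`d(Z_{r-1}^{p - r + 1, n - p + r - 2}) = Fᵖ Cⁿ ∩ d(Fᵖ⁻ʳ⁺¹ Cⁿ⁻¹)` (with `Fᵏ = F⁰` for `k ≤ 0`). -/
def bd (r p : ℕ) : (n : ℕ) → AddSubgroup ((Fin n → Ω) → A)
  | 0 => ⊥
  | n + 1 => S.Fil A p (n + 1) ⊓ (S.Fil A (p + 1 - r) n).map (d (S.infl ρ) n)

/-- The term `E_r^{p, q} = Z_r^{p, q} / (Z_{r-1}^{p + 1, q - 1} + d(Z_{r-1}^{p - r + 1, q + r - 2}))`,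
for `r ≥ 1`, of the Hochschild-Serre spectral sequence, that is, of the spectral sequence of the
filtered complex `Fᵖ Cⁿ`. -/
abbrev HSPage (r p q : ℕ) : Type _ :=
  S.cyc ρ r p (p + q) ⧸
    (S.cyc ρ (r - 1) (p + 1) (p + q) ⊔ S.bd ρ r p (p + q)).addSubgroupOf (S.cyc ρ r p (p + q))

variable {S ρ}

lemma cyc_congr {f : (Fin 2 → Ω) → A} (hf : f ∈ S.cyc ρ 2 1 2) (x : Ω) {y y' : Ω}
    (h : S.proj y = S.proj y') : f ![x, y] = f ![x, y'] := by
  refine hf.1.2.1 _ _ (fun i hi => ?_) (fun i => ?_)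
  · obtain rfl : i = 0 := Fin.ext (by simp only [Fin.val_zero]; omega)
    rfl
  · fin_cases i
    · rfl
    · exact h

lemma cyc_d_congr {f : (Fin 2 → Ω) → A} (hf : f ∈ S.cyc ρ 2 1 2) {x x' y y' z z' : Ω}
    (hx : S.proj x = S.proj x') (hy : S.proj y = S.proj y') (hz : S.proj z = S.proj z') :
    S.infl ρ x (f ![y, z]) - f ![x * y, z] + f ![x, y * z] - f ![x, y] =
      S.infl ρ x' (f ![y', z']) - f ![x' * y', z'] + f ![x', y' * z'] - f ![x', y'] := by
  rw [← d_two, ← d_two]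
  have h : d (S.infl ρ) 2 f ∈ S.Fil A 3 3 := hf.2
  refine h.2.1 _ _ (fun i hi => by omega) (fun i => ?_)
  fin_cases i
  · exact hx
  · exact hy
  · exact hz

lemma cyc_incl_one {f : (Fin 2 → Ω) → A} (hf : f ∈ S.cyc ρ 2 1 2) (m : M) :
    f ![S.incl m, 1] = f ![1, 1] := by
  have h := cyc_d_congr hf (x := S.incl m) (x' := 1) (y := 1) (y' := 1) (z := 1) (z' := 1)
    (by rw [proj_incl, map_one]) rfl rfl
  rw [infl_incl, map_one] at h
  simp only [mul_one, AddMonoid.End.coe_one, id_eq] at h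
  rw [← sub_eq_zero, ← neg_eq_zero]
  rw [← sub_eq_zero] at h
  rw [← h]
  abel

lemma cyc_incl_mul {f : (Fin 2 → Ω) → A} (hf : f ∈ S.cyc ρ 2 1 2) (m m' : M) (y : Ω) :
    f ![S.incl (m * m'), y] - f ![1, y] =
      (f ![S.incl m, y] - f ![1, y]) + (f ![S.incl m', y] - f ![1, y]) := by
  have h := cyc_d_congr hf (x := S.incl m) (x' := 1) (y := S.incl m') (y' := 1) (z := y) (z' := y)
    (by rw [proj_incl, map_one]) (by rw [proj_incl, map_one]) rfl
  rw [cyc_congr hf (S.incl m) (y := S.incl m' * y) (y' := y)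
      (by rw [map_mul, proj_incl, one_mul]),
    cyc_congr hf (S.incl m) (y := S.incl m') (y' := 1) (by rw [proj_incl, map_one]),
    cyc_incl_one hf, infl_incl, map_one, ← map_mul] at h
  simp only [mul_one, one_mul, AddMonoid.End.coe_one, id_eq] at h
  rw [← sub_eq_zero] at h ⊢
  rw [← neg_eq_zero, ← h]
  abel

lemma cyc_mul_incl {f : (Fin 2 → Ω) → A} (hf : f ∈ S.cyc ρ 2 1 2) (x : Ω) (m : M) (y : Ω) :
    f ![x * S.incl m, y] - f ![x, y] = S.infl ρ x (f ![S.incl m, y] - f ![1, y]) := by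
  have h := cyc_d_congr hf (x := x) (x' := x) (y := S.incl m) (y' := 1) (z := y) (z' := y)
    rfl (by rw [proj_incl, map_one]) rfl
  rw [cyc_congr hf x (y := S.incl m * y) (y' := y) (by rw [map_mul, proj_incl, one_mul]),
    cyc_congr hf x (y := S.incl m) (y' := 1) (by rw [proj_incl, map_one])] at h
  simp only [mul_one, one_mul] at h
  rw [map_sub]
  rw [← sub_eq_zero] at h ⊢
  rw [← neg_eq_zero, ← h]
  abel

/-- Restriction of the first argument of `f ∈ Z_2^{1, 1}` to `M`: the function
`g ↦ (m ↦ f(m, g̃) - f(1, g̃))`, where `g̃ ∈ Ω` lifts `g ∈ Q`, with values in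
`Hom(M, A) = H¹(M, A)`. The term `f(1, g̃)`, which is zero for normalized cochains, makes the
`1`-cochain `f(·, g̃)` of `M` a cocycle. -/
noncomputable def restrictFun (f : S.cyc ρ 2 1 2) : (Fin 1 → Q) → Additive M →+ A := fun g =>
  { toFun := fun m => f.1 ![S.incl m.toMul, S.lift (g 0)] - f.1 ![1, S.lift (g 0)]
    map_zero' := by rw [toMul_zero, map_one, sub_self]
    map_add' := fun m m' => by rw [toMul_add, cyc_incl_mul f.2] }

lemma restrictFun_apply (f : S.cyc ρ 2 1 2) (x : Ω) (m : Additive M) :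
    restrictFun f ![S.proj x] m = f.1 ![S.incl m.toMul, x] - f.1 ![1, x] := by
  change f.1 ![S.incl m.toMul, S.lift (S.proj x)] - f.1 ![1, S.lift (S.proj x)] = _
  rw [cyc_congr f.2 _ (S.proj_lift (S.proj x)), cyc_congr f.2 _ (S.proj_lift (S.proj x))]

lemma mul_incl_eq (x : Ω) (m : Additive M) :
    S.incl m.toMul * x = x * S.incl (S.act (S.proj x)⁻¹ m).toMul := by
  rw [← map_inv, incl_act]
  group

lemma restrictFun_mem_Z [IsTopologicalGroup Ω] [Finite M] (f : S.cyc ρ 2 1 2) :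
    restrictFun f ∈ Z (S.homAct ρ) 1 := by
  rw [mem_Z_one]
  constructor
  · have key : IsLocallyConstant fun g : Q => restrictFun f ![g] := by
      refine S.isLocallyConstant_of_comp ?_
      rw [IsLocallyConstant.iff_eventually_eq]
      intro x
      have key : ∀ᶠ y in nhds x, ∀ m : M, restrictFun f ![S.proj y] (Additive.ofMul m) =
          restrictFun f ![S.proj x] (Additive.ofMul m) := by
        rw [Filter.eventually_all]
        intro m
        simp only [restrictFun_apply]
        have h : ∀ t : Ω, IsLocallyConstant fun y => f.1 ![t, y] := fun t =>
          IsLocallyConstant.comp_continuous (f := fun y : Ω => ![t, y]) (g := f.1) f.2.1.1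
            (by fun_prop)
        exact ((h _).sub (h _)).eventually_eq x
      filter_upwards [key] with y hy
      exact AddMonoidHom.ext hy
    have h2 := key.comp_continuous (f := fun g : Fin 1 → Q => g 0) (by fun_prop)
    have h3 : restrictFun f = fun g => restrictFun f ![g 0] :=
      funext fun g => congrArg _ (vec_one g)
    rw [h3]
    exact h2
  · intro g h
    obtain ⟨x, rfl⟩ := S.rightHom_surjective g
    obtain ⟨y, rfl⟩ := S.rightHom_surjective h
    change restrictFun f ![S.proj x * S.proj y] =
      restrictFun f ![S.proj x] + S.homAct ρ (S.proj x) (restrictFun f ![S.proj y])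
    refine AddMonoidHom.ext fun m => ?_
    change restrictFun f _ m = restrictFun f _ m + ρ _ (restrictFun f _ _)
    rw [← map_mul, restrictFun_apply, restrictFun_apply, restrictFun_apply, ← infl_apply,
      ← cyc_mul_incl f.2]
    change _ = _ + (f.1 ![x * S.incl (S.act (S.proj x)⁻¹ m).toMul, y] - _)
    rw [← mul_incl_eq]
    have h := cyc_d_congr f.2 (x := S.incl m.toMul) (x' := 1) (y := x) (y' := x) (z := y)
      (z' := y) (by rw [proj_incl, map_one]) rfl rfl
    rw [infl_incl, map_one] at h
    simp only [one_mul, AddMonoid.End.coe_one, id_eq] at h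
    rw [← sub_eq_zero] at h ⊢
    rw [← h]
    abel

lemma restrictFun_mem_B_of_cyc (f : S.cyc ρ 2 1 2) (hf : f.1 ∈ S.cyc ρ 1 2 2) :
    restrictFun f = 0 := by
  refine funext fun g => AddMonoidHom.ext fun m => ?_
  change f.1 ![S.incl m.toMul, S.lift (g 0)] - f.1 ![1, S.lift (g 0)] = 0
  rw [sub_eq_zero]
  refine hf.1.2.1 _ _ (fun i hi => by omega) (fun i => ?_)
  fin_cases i
  · change S.proj (S.incl m.toMul) = S.proj 1
    rw [proj_incl, map_one]
  · rfl

lemma restrictFun_mem_B_of_bd [Finite M] [DiscreteTopology M] (f : S.cyc ρ 2 1 2)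
    (hf : f.1 ∈ S.bd ρ 2 1 2) : restrictFun f ∈ B (S.homAct ρ) 1 := by
  obtain ⟨-, g, -, hg⟩ := hf
  have hf : ∀ x y, f.1 ![x, y] = S.infl ρ x (g ![y]) - g ![x * y] + g ![x] := fun x y => by
    rw [← hg, d_one]
  have hmul : ∀ (x : Ω) (m : M), g ![x * S.incl m] = g ![x] +
      S.infl ρ x (g ![S.incl m] - g ![1]) := fun x m => by
    have h := cyc_congr f.2 x (y := S.incl m) (y' := 1) (by rw [proj_incl, map_one])
    rw [hf, hf, mul_one] at h
    rw [map_sub]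
    rw [← sub_eq_zero] at h ⊢
    rw [← neg_eq_zero, ← h]
    abel
  let φ : Additive M →+ A :=
    { toFun := fun m => g ![1] - g ![S.incl m.toMul]
      map_zero' := by rw [toMul_zero, map_one, sub_self]
      map_add' := fun m m' => by
        rw [toMul_add, map_mul, hmul, infl_incl]
        change g ![1] - (g ![S.incl m.toMul] + (g ![S.incl m'.toMul] - g ![1])) = _
        abel }
  refine ⟨fun _ => φ, IsLocallyConstant.const φ, ?_⟩
  refine funext fun q => AddMonoidHom.ext fun m => ?_
  rw [vec_one q, d_zero]
  obtain ⟨x, hx⟩ := S.rightHom_surjective (q 0)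
  replace hx : S.proj x = q 0 := hx
  rw [← hx, restrictFun_apply, hf, hf]
  change ρ (S.proj x) (g ![1] - g ![S.incl (S.act (S.proj x)⁻¹ m).toMul]) -
    (g ![1] - g ![S.incl m.toMul]) = _
  have h := hmul x (S.act (S.proj x)⁻¹ m).toMul
  rw [← mul_incl_eq, infl_apply] at h
  rw [h, infl_incl, map_one, one_mul, map_sub, map_sub]
  simp only [AddMonoid.End.coe_one, id_eq]
  abel

variable (S ρ)

/-- The identification of `E_2^{1, 1}` with `H¹(Q, H¹(M, A)) = H¹(Q, Hom(M, A))`, induced by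
restricting the first argument of the cochains `f(x, y)` in `F¹ C²` to `M`. -/
noncomputable def pageToH [IsTopologicalGroup Ω] [Finite M] [DiscreteTopology M] :
    S.HSPage ρ 2 1 1 →+ H (S.homAct ρ) 1 :=
  QuotientAddGroup.map _ _
    { toFun := fun f => (⟨restrictFun (S := S) (ρ := ρ) f, restrictFun_mem_Z f⟩ :
        Z (S.homAct ρ) 1)
      map_zero' := by
        refine Subtype.ext (funext fun g => AddMonoidHom.ext fun m => ?_)
        exact sub_self _
      map_add' := fun f f' => by
        refine Subtype.ext (funext fun g => AddMonoidHom.ext fun m => ?_)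
        exact add_sub_add_comm _ _ _ _ }
    (by
      intro f hf
      change restrictFun (S := S) (ρ := ρ) f ∈ B (S.homAct ρ) 1
      obtain ⟨f₁, hf₁, f₂, hf₂, h⟩ := AddSubgroup.mem_sup.1 (AddSubgroup.mem_addSubgroupOf.1 hf)
      have h₁ : f₁ ∈ S.cyc ρ 2 1 2 :=
        ⟨⟨hf₁.1.1, fun x y h h' => hf₁.1.2.1 x y (fun i hi => h i (by omega)) h',
          fun h => absurd h (by omega)⟩, hf₁.2⟩
      have h₂ : f₂ ∈ S.cyc ρ 2 1 2 := by
        rw [← add_sub_cancel_left f₁ f₂, h]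
        exact sub_mem f.2 h₁
      have key : restrictFun f = restrictFun (S := S) (ρ := ρ) ⟨f₁, h₁⟩ +
          restrictFun (S := S) (ρ := ρ) ⟨f₂, h₂⟩ := by
        refine funext fun g => AddMonoidHom.ext fun m => ?_
        change f.1 _ - f.1 _ = (f₁ _ - f₁ _) + (f₂ _ - f₂ _)
        rw [← add_sub_add_comm]
        exact congrArg₂ (· - ·) (congrFun h _).symm (congrFun h _).symm
      rw [key, restrictFun_mem_B_of_cyc _ hf₁, zero_add]
      exact restrictFun_mem_B_of_bd _ hf₂)

/-- The group `H²(Ω, A)₀`: the kernel of the restriction map `H²(Ω, A) → H²(M, A)`. -/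
abbrev H2Zero : AddSubgroup (H (S.infl ρ) 2) := (S.res ρ).ker

/-- The `2`-cocycles of `Ω` which lie in `F¹ C²`. -/
def Z2Fil : AddSubgroup ((Fin 2 → Ω) → A) := Z (S.infl ρ) 2 ⊓ S.Fil A 1 2

variable {S ρ} in
lemma mem_cyc_of_mem_Z2Fil {f : (Fin 2 → Ω) → A} (hf : f ∈ S.Z2Fil ρ) : f ∈ S.cyc ρ 2 1 2 := by
  refine ⟨hf.2, ?_⟩
  change d (S.infl ρ) 2 f ∈ S.Fil A (1 + 2) (2 + 1)
  rw [AddMonoidHom.mem_ker.1 hf.1.2]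
  exact zero_mem _

variable {S ρ} in
lemma res_mk_eq_zero (f : Z (S.infl ρ) 2) :
    S.res ρ (QuotientAddGroup.mk f) = 0 ↔ pull S.incl 2 f.1 ∈ B (S.trivAct ρ) 2 := by
  change QuotientAddGroup.mk _ = _ ↔ _
  rw [QuotientAddGroup.eq_zero_iff, AddSubgroup.mem_addSubgroupOf]
  rfl

lemma trivAct_apply (m : M) : S.trivAct ρ m = 1 := S.infl_incl ρ m

variable {S ρ} in
lemma pull_incl {f : (Fin 2 → Ω) → A} (m m' : M) :
    pull S.incl 2 f ![m, m'] = f ![S.incl m, S.incl m'] := by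
  change f _ = f _
  congr 1
  ext i
  fin_cases i <;> rfl

/-- The class in `H²(Ω, A)₀` of a cocycle in `F¹ C²`. -/
def Z2FilToH : S.Z2Fil ρ →+ S.H2Zero ρ where
  toFun f := ⟨QuotientAddGroup.mk ⟨f.1, f.2.1⟩, by
    rw [AddMonoidHom.mem_ker, res_mk_eq_zero]
    have hf := mem_cyc_of_mem_Z2Fil f.2
    refine ⟨fun _ => f.1 ![1, 1], IsLocallyConstant.const _, ?_⟩
    ext g
    have h : f.1 ![S.incl (g 0), S.incl (g 1)] = f.1 ![1, 1] := by
      rw [cyc_congr hf _ (y := S.incl (g 1)) (y' := 1) (by rw [proj_incl, map_one]),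
        cyc_incl_one hf]
    rw [vec_two g, d_one, pull_incl, trivAct_apply, h]
    exact sub_add_cancel _ _⟩
  map_zero' := rfl
  map_add' _ _ := rfl

/-- The class in `E_2^{1, 1}` of a cocycle in `F¹ C²`. -/
def Z2FilToPage : S.Z2Fil ρ →+ S.HSPage ρ 2 1 1 where
  toFun f := QuotientAddGroup.mk ⟨f.1, mem_cyc_of_mem_Z2Fil f.2⟩
  map_zero' := rfl
  map_add' _ _ := rfl

lemma ker_Z2FilToH_le : (S.Z2FilToH ρ).ker ≤ (S.Z2FilToPage ρ).ker := by
  intro f hf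
  have hf' : (QuotientAddGroup.mk ⟨f.1, f.2.1⟩ : H (S.infl ρ) 2) = 0 :=
    congrArg Subtype.val (AddMonoidHom.mem_ker.1 hf)
  rw [QuotientAddGroup.eq_zero_iff, AddSubgroup.mem_addSubgroupOf] at hf'
  obtain ⟨g, hg, hgf⟩ := hf'
  change QuotientAddGroup.mk _ = _
  rw [QuotientAddGroup.eq_zero_iff, AddSubgroup.mem_addSubgroupOf]
  refine AddSubgroup.mem_sup_right ⟨f.2.2, g, ⟨hg, fun x y h _ => ?_, fun h => absurd h (by omega)⟩,
    hgf⟩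
  rw [funext fun i => h i (by omega)]

/-- `Ω` is, as a right `M`-space, the product of `M` with a quotient space. -/
lemma exists_retraction [IsProdiscrete Ω] [Finite M] [DiscreteTopology M] :
    ∃ μ : Ω → M, IsLocallyConstant μ ∧ μ 1 = 1 ∧ ∀ x m, μ (x * S.incl m) = μ x * m := by
  obtain ⟨V, hV, hV1⟩ : ∃ V : Set Ω, IsOpen V ∧ S.incl ⁻¹' V = {1} :=
    S.isEmbedding_inl.isOpen_iff.1 (isOpen_discrete {1})
  have hmem : (1 : Ω) ∈ V := by
    have : (1 : M) ∈ S.incl ⁻¹' V := by rw [hV1]; rfl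
    simpa using this
  obtain ⟨U, hU⟩ := IsProdiscrete.exists_openNormalSubgroup_subset V (hV.mem_nhds hmem)
  have hU1 : ∀ m, S.incl m ∈ U → m = 1 := fun m hm => by
    have : m ∈ S.incl ⁻¹' V := hU hm
    rwa [hV1] at this
  let N : Subgroup Ω := U.toSubgroup
  have : N.Normal := U.isNormal'
  have hUo : IsOpen (N : Set Ω) := U.isOpen'
  have hN1 : ∀ m, S.incl m ∈ N → m = 1 := hU1
  let K : Subgroup (Ω ⧸ N) := S.incl.toMonoidHom.range.map (QuotientGroup.mk' N)
  have hex : ∀ y : Ω ⧸ N, ∃ m : M,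
      y = (QuotientGroup.mk y : (Ω ⧸ N) ⧸ K).out * QuotientGroup.mk' N (S.incl m) := fun y => by
    have h : (QuotientGroup.mk y : (Ω ⧸ N) ⧸ K).out⁻¹ * y ∈ K :=
      QuotientGroup.eq.1 (QuotientGroup.out_eq' _)
    obtain ⟨_, ⟨m, rfl⟩, hm⟩ := h
    refine ⟨m, ?_⟩
    rw [eq_comm, ← eq_inv_mul_iff_mul_eq]
    exact hm
  choose ν hν using hex
  have hνmul : ∀ y m, ν (y * QuotientGroup.mk' N (S.incl m)) = ν y * m := fun y m => by
    have h1 := hν (y * QuotientGroup.mk' N (S.incl m))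
    have h2 : (QuotientGroup.mk (y * QuotientGroup.mk' N (S.incl m)) : (Ω ⧸ N) ⧸ K) =
        QuotientGroup.mk y := by
      rw [eq_comm, QuotientGroup.eq, inv_mul_cancel_left]
      exact ⟨_, ⟨m, rfl⟩, rfl⟩
    rw [h2] at h1
    nth_rewrite 1 [hν y] at h1
    rw [mul_assoc, mul_right_inj, ← map_mul, ← map_mul] at h1
    have h3 : S.incl ((ν y * m)⁻¹ * ν (y * QuotientGroup.mk' N (S.incl m))) ∈ N := by
      rw [map_mul, map_inv]
      exact QuotientGroup.eq.1 h1
    rw [eq_comm, ← inv_mul_eq_one]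
    exact hN1 _ h3
  have : DiscreteTopology (Ω ⧸ N) := QuotientGroup.discreteTopology hUo
  refine ⟨fun x => (ν 1)⁻¹ * ν (QuotientGroup.mk' N x), ?_, ?_, fun x m => ?_⟩
  · have h : IsLocallyConstant fun y => (ν 1)⁻¹ * ν y := IsLocallyConstant.of_discrete _
    exact h.comp_continuous (f := QuotientGroup.mk' N) continuous_quotient_mk'
  · simp only [map_one, inv_mul_cancel]
  · beta_reduce
    rw [map_mul, hνmul, mul_assoc]

lemma d_one_mem_Z [IsProdiscrete Ω] [IsDiscreteModule (S.infl ρ)] {g : (Fin 1 → Ω) → A}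
    (hg : IsLocallyConstant g) : d (S.infl ρ) 1 g ∈ Z (S.infl ρ) 2 := by
  rw [mem_Z_two]
  constructor
  · have h : d (S.infl ρ) 1 g = fun x => S.infl ρ (x 0) (g ![x 1]) - g ![x 0 * x 1] + g ![x 0] :=
      funext fun x => by
        conv_lhs => rw [vec_two x]
        rw [d_one]
    rw [h]
    refine ((IsDiscreteModule.smul _ (by fun_prop) (hg.comp_continuous (by fun_prop))).sub
      (hg.comp_continuous (by fun_prop))).add (hg.comp_continuous (by fun_prop))
  · intro x y z
    simp only [d_one, map_add, map_sub, map_mul, AddMonoid.End.coe_mul, Function.comp_apply,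
      mul_assoc]
    abel

instance isDiscreteModule_infl [IsDiscreteModule ρ] : IsDiscreteModule (S.infl ρ) where
  isLocallyConstant a :=
    (IsDiscreteModule.isLocallyConstant (ρ := ρ) a).comp_continuous S.proj.continuous_toFun

lemma Z2FilToH_surjective [IsProdiscrete Ω] [Finite M] [DiscreteTopology M] [IsDiscreteModule ρ] :
    Function.Surjective (S.Z2FilToH ρ) := by
  rintro ⟨c, hc⟩
  obtain ⟨⟨f, hfZ⟩, rfl⟩ := QuotientAddGroup.mk_surjective c
  rw [AddMonoidHom.mem_ker, res_mk_eq_zero] at hc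
  obtain ⟨a, ha, haf⟩ := hc
  obtain ⟨μ, hμ, hμ1, hμm⟩ := S.exists_retraction
  have hμi : ∀ m, μ (S.incl m) = m := fun m => by
    rw [← one_mul (S.incl m), hμm, hμ1, one_mul]
  have hcμ : Continuous fun x => S.incl (μ x) := (hμ.comp S.incl).continuous
  let a' : (Fin 1 → Ω) → A := fun g => a ![μ (g 0)]
  have ha' : IsLocallyConstant a' :=
    (hμ.comp fun m => a ![m]).comp_continuous (f := fun g : Fin 1 → Ω => g 0) (by fun_prop)
  let f₁ : (Fin 2 → Ω) → A := f - d (S.infl ρ) 1 a'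
  have hf₁ : f₁ ∈ Z (S.infl ρ) 2 := sub_mem hfZ (S.d_one_mem_Z ρ ha')
  have hf₁M : ∀ m m', f₁ ![S.incl m, S.incl m'] = 0 := fun m m' => by
    have h := congrFun haf ![m, m']
    rw [d_one, pull_incl, trivAct_apply] at h
    change f ![S.incl m, S.incl m'] - d (S.infl ρ) 1 a' ![S.incl m, S.incl m'] = 0
    change _ = f ![S.incl m, S.incl m'] at h
    rw [d_one, ← h, infl_incl, ← map_mul]
    change _ - (_ - a ![μ (S.incl (m * m'))] + a ![μ (S.incl m)]) = 0
    rw [hμi, hμi]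
    change _ - (a ![μ (S.incl m')] - _ + _) = 0
    rw [hμi]
    exact sub_self _
  let g : (Fin 1 → Ω) → A := fun x => f₁ ![x 0 * (S.incl (μ (x 0)))⁻¹, S.incl (μ (x 0))]
  have hg : IsLocallyConstant g := IsLocallyConstant.comp_continuous (g := f₁)
    (f := fun x : Fin 1 → Ω => ![x 0 * (S.incl (μ (x 0)))⁻¹, S.incl (μ (x 0))]) hf₁.1 (by
      have h := hcμ.comp (continuous_apply (A := fun _ : Fin 1 => Ω) 0)
      have h' : Continuous fun x : Fin 1 → Ω => S.incl (μ (x 0)) := h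
      fun_prop)
  let f₂ : (Fin 2 → Ω) → A := f₁ + d (S.infl ρ) 1 g
  have hf₂ : f₂ ∈ Z (S.infl ρ) 2 := add_mem hf₁ (S.d_one_mem_Z ρ hg)
  have hf₂M : ∀ x m, f₂ ![x, S.incl m] = 0 := fun x m => by
    change f₁ ![x, S.incl m] + d (S.infl ρ) 1 g ![x, S.incl m] = 0
    have h1 : g ![S.incl m] = 0 := by
      change f₁ ![S.incl m * (S.incl (μ (S.incl m)))⁻¹, S.incl (μ (S.incl m))] = 0
      rw [hμi, mul_inv_cancel, ← map_one S.incl]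
      exact hf₁M 1 m
    have h2 : g ![x * S.incl m] = f₁ ![x * (S.incl (μ x))⁻¹, S.incl (μ x) * S.incl m] := by
      change f₁ ![x * S.incl m * (S.incl (μ (x * S.incl m)))⁻¹, S.incl (μ (x * S.incl m))] = _
      rw [hμm, map_mul, mul_inv_rev]
      congr 2
      group
    have h3 : g ![x] = f₁ ![x * (S.incl (μ x))⁻¹, S.incl (μ x)] := rfl
    have h4 := (mem_Z_two.1 hf₁).2 (x * (S.incl (μ x))⁻¹) (S.incl (μ x)) (S.incl m)
    rw [hf₁M, map_zero, inv_mul_cancel_right] at h4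
    rw [d_one, h1, h2, h3, map_zero, ← neg_eq_zero]
    refine Eq.trans ?_ h4
    abel
  have hf₂F : f₂ ∈ S.Fil A 1 2 := by
    refine ⟨hf₂.1, fun x y h h' => ?_, fun h => absurd h (by omega)⟩
    obtain ⟨m, hm⟩ := S.exists_eq_mul (h' 1)
    have h4 := (mem_Z_two.1 hf₂).2 (x 0) (x 1) (S.incl m)
    rw [hf₂M, hf₂M, map_zero, ← hm, sub_zero, zero_add, sub_eq_zero] at h4
    rw [vec_two x, vec_two y, ← h 0 (by simp), ← h4]
  refine ⟨⟨f₂, hf₂, hf₂F⟩, Subtype.ext ?_⟩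
  change (QuotientAddGroup.mk ⟨f₂, hf₂⟩ : H (S.infl ρ) 2) = QuotientAddGroup.mk ⟨f, hfZ⟩
  rw [QuotientAddGroup.eq, AddSubgroup.mem_addSubgroupOf]
  refine ⟨a' - g, (C Ω A 1).sub_mem ha' hg, ?_⟩
  change _ = -(f - d (S.infl ρ) 1 a' + d (S.infl ρ) 1 g) + f
  rw [map_sub]
  abel

/-- The edge map `H²(Ω, A)₀ = F¹ H²(Ω, A) → E_2^{1, 1}` of the Hochschild-Serre spectral sequence:
it maps the class of a cocycle `f ∈ F¹ C²` to the class of `f` in `E_2^{1, 1}`. -/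
noncomputable def edge [IsProdiscrete Ω] [Finite M] [DiscreteTopology M] [IsDiscreteModule ρ] :
    S.H2Zero ρ →+ S.HSPage ρ 2 1 1 :=
  (S.Z2FilToH ρ).liftOfSurjective (S.Z2FilToH_surjective ρ) ⟨S.Z2FilToPage ρ, S.ker_Z2FilToH_le ρ⟩

/-- The homomorphism `δ : H²(Ω, A)₀ → H¹(Q, Hom(M, A))` furnished by the Hochschild-Serre spectral
sequence. -/
noncomputable def delta [IsProdiscrete Ω] [Finite M] [DiscreteTopology M] [IsDiscreteModule ρ] :
    S.H2Zero ρ →+ H (S.homAct ρ) 1 :=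
  (S.pageToH ρ).comp (S.edge ρ)

end HochschildSerre

end ProdiscreteExtension

end Extension

end DiscreteCohomology

namespace DiscreteCohomology.ProdiscreteExtension

variable {M Ω Q A : Type*} [CommGroup M] [TopologicalSpace M]
  [Group Ω] [TopologicalSpace Ω] [Group Q] [TopologicalSpace Q] [AddCommGroup A]
  {S : ProdiscreteExtension M Ω Q} {ρ : Q →* AddMonoid.End A}

/-! For a suitable representative of `c` the formula already holds between cochains, with no
coboundary to correct it. A class that dies on `M` is represented by a cocycle `f` in `F¹ C²`, so
that `f(x, y)` depends on `y` only modulo `M`; this is `Z2FilToH_surjective`. Its proof rests on a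
locally constant, right `M`-equivariant map `Ω → M`, which exists because some open normal subgroup
meets `M` trivially. The map extends to `Ω` a cochain trivialising the restriction to `M`, and a
second coboundary then makes the cocycle vanish on `Ω × M`. The cocycle relation at `(x, y, m)` now
gives `f(x, ym) = f(x, y)`. For such an `f`, comparing `d f` at `(x, m, y)` and `(x, 1, y)` gives
`f(xm, y) - f(x, y) = x (f(m, y) - f(1, y))`, which is `cyc_mul_incl`. With `v(h)(m) = f(m, h̃) -
f(1, h̃)`, a cocycle representing `δ(c)`, the right-hand side is `x` applied to `v` at the image of
`y`, evaluated at `m`. Put `m = s₁(g) s₂(g)⁻¹`, so that `s₁(g) = m s₂(g) = s₂(g) (g⁻¹m)`. Since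
`s₁(h)` and `s₂(h)` lie in the same coset of `M`, the difference `f(s₁(g), s₁(h)) - f(s₂(g), s₂(h))`
equals `g (v(h)(g⁻¹m)) = (g v(h))(m)`, the value at `(g, h)` of the cup product of the difference
cocycle with `v`. This is `pull_sub_pull_eq_cupCochain`. The same `f` may be used on both sides
because the edge map can be computed on any representative in `F¹ C²` (`edge_Z2FilToH`). -/

lemma pull_section (s : S.ContSection) (f : (Fin 2 → Ω) → A) (g h : Q) :
    pull s.hom 2 f ![g, h] = f ![s.hom g, s.hom h] :=
  congrArg f (by ext i; fin_cases i <;> rfl)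

/-- For a cochain `f` representing a class in `E_2^{1, 1}`, the pull-backs of `f` along two sections
differ by the cup product of the difference cocycle with the restriction of `f`. -/
lemma pull_sub_pull_eq_cupCochain (f : S.cyc ρ 2 1 2) (s₁ s₂ : S.ContSection) :
    pull s₁.hom 2 f.1 - pull s₂.hom 2 f.1 =
      cupCochain (S.homAct ρ) ev (diffCochain s₁ s₂) (restrictFun f) := by
  ext t
  obtain ⟨g, h, rfl⟩ : ∃ g h, t = ![g, h] := ⟨_, _, vec_two t⟩
  set m := diffCochain s₁ s₂ ![g] with hm
  -- The cocycle places `m` to the left of `s₂(g)`, while `cyc_mul_incl` splits off a factor of `M`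
  -- on the right of the first argument. Conjugating `m` past `s₂(g)` turns it into `g⁻¹m`, which is
  -- exactly the twist in the action on `Hom(M, A)`.
  have hs : s₁.hom g = s₂.hom g * S.incl (S.act g⁻¹ m).toMul := by
    have h1 := mul_incl_eq (S := S) (s₂.hom g) m
    rw [s₂.proj_hom] at h1
    rw [← h1, hm, incl_diffCochain]
    simp
  -- `restrictFun` is defined through an arbitrary set-theoretic lift of `h`; since `f` ignores `M`
  -- in its second argument, `s₂(h)` serves equally well.
  have hv : restrictFun f ![h] (S.act g⁻¹ m) =
      f.1 ![S.incl (S.act g⁻¹ m).toMul, s₂.hom h] - f.1 ![1, s₂.hom h] := by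
    rw [← restrictFun_apply, s₂.proj_hom]
  -- The right-hand side is `(g v(h))(m)` with the action on `Hom(M, A)` unfolded.
  change pull s₁.hom 2 f.1 ![g, h] - pull s₂.hom 2 f.1 ![g, h] =
    ρ g (restrictFun f ![h] (S.act g⁻¹ m))
  -- Once `s₁(h)` is replaced by `s₂(h)`, the two values of `f` differ only by the factor `g⁻¹m` in
  -- the first argument, and `cyc_mul_incl` evaluates their difference.
  rw [pull_section, pull_section, hs, hv, cyc_congr f.2 _
    (show S.proj (s₁.hom h) = S.proj (s₂.hom h) by rw [s₁.proj_hom, s₂.proj_hom]),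
    cyc_mul_incl f.2, infl_apply, s₂.proj_hom]

/-- The edge map is built from a choice of one filtered cocycle in each class. By `ker_Z2FilToH_le`
the choice does not affect the class in `E_2^{1, 1}`, so every filtered cocycle computes it. -/
lemma edge_Z2FilToH [IsProdiscrete Ω] [Finite M] [DiscreteTopology M] [IsDiscreteModule ρ]
    (f : S.Z2Fil ρ) : S.edge ρ (S.Z2FilToH ρ f) = S.Z2FilToPage ρ f :=
  AddMonoidHom.liftOfRightInverse_comp_apply _ _ _ _ f

end DiscreteCohomology.ProdiscreteExtension

theorem corollary6p5 {M Ω Q A : Type*}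
    [CommGroup M] [Finite M] [TopologicalSpace M] [DiscreteTopology M]
    [Group Ω] [TopologicalSpace Ω] [DiscreteCohomology.IsProdiscrete Ω]
    [Group Q] [TopologicalSpace Q] [DiscreteCohomology.IsProdiscrete Q]
    (S : DiscreteCohomology.ProdiscreteExtension M Ω Q)
    [AddCommGroup A] (ρ : Q →* AddMonoid.End A) [DiscreteCohomology.IsDiscreteModule ρ]
    (c : S.H2Zero ρ) (s₁ s₂ : S.ContSection) :
    S.pullSection ρ s₁ c - S.pullSection ρ s₂ c =
      DiscreteCohomology.cup DiscreteCohomology.ProdiscreteExtension.ev (S.ev_equivariant ρ)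
        (DiscreteCohomology.ProdiscreteExtension.diffClass s₁ s₂) (S.delta ρ c) := by
  -- From here on `c` is the class of a cocycle `f` in `F¹ C²`.
  obtain ⟨f, rfl⟩ := S.Z2FilToH_surjective ρ c
  -- This expresses `δ(c)` through `f` itself instead of the representative hidden in the definition
  -- of the edge map.
  have hδ : S.delta ρ (S.Z2FilToH ρ f) = S.pageToH ρ (S.Z2FilToPage ρ f) :=
    congrArg (S.pageToH ρ) (DiscreteCohomology.ProdiscreteExtension.edge_Z2FilToH f)
  rw [hδ]
  -- All the maps involved are induced from cochains, so both sides reduce by definition to classes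
  -- of explicit `2`-cocycles on `Q`. These are equal as functions, not merely cohomologous.
  refine congrArg QuotientAddGroup.mk (Subtype.ext ?_)
  exact DiscreteCohomology.ProdiscreteExtension.pull_sub_pull_eq_cupCochain
    ⟨f.1, DiscreteCohomology.ProdiscreteExtension.mem_cyc_of_mem_Z2Fil f.2⟩ s₁ s₂
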